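/- Let $C^\infty(\mathbb{R}^2)$ be the algebra of smooth real functions on $\mathbb{R}^2$ and let $E\subseteq \mathrm{Vect}(\mathbb{R}^2)$ be the $C^\infty(\mathbb{R}^2)$-submodule of the smooth vector fields on $\mathbb{R}^2$ generated by $$v_1 = x\frac{\partial}{\partial x}+y\frac{\partial}{\partial y},\qquad v_2=-y\frac{\partial}{\partial x}+x\frac{\partial}{\partial y};$$ it is free with basis $v_1,v_2$ and satisfies $[E,E]\subseteq E$. For an integer $k\ge 0$ let ${}^E\Omega^k(\mathbb{R}^2)$ be the space of $E$-forms of degree $k$, that is, of alternating $C^\infty(\mathbb{R}^2)$-multilinear maps $\omega: E^k\to C^\infty(\mathbb{R}^2)$ (equivalently, smooth global sections of $\wedge^k({}^ET^*\mathbb{R}^2)$, where ${}^ET\mathbb{R}^2$ is the vector bundle whose sections are the elements of $E$), and let ${}^E\Omega^k(\mathbb{R}^2)=0$ for $k<0$. Let $d:{}^E\Omega^k(\mathbb{R}^2)\to{}^E\Omega^{k+1}(\mathbb{R}^2)$ be the differential $$d\omega(V_0,\dots,V_k)=\sum_i(-1)^iV_i\big(\omega(V_0,\dots,\hat V_i,\dots,V_k)\big)+\sum_{i<j}(-1)^{i+j}\omega\big([V_i,V_j],V_0,\dots,\hat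 V_i,\dots,\hat V_j,\dots,V_k\big).$$ Then the $E$-cohomology ${}^EH^k(\mathbb{R}^2)=\ker\big(d|_{{}^E\Omega^k}\big)/d\big({}^E\Omega^{k-1}\big)$ is, as a real vector space, $${}^EH^k(\mathbb{R}^2)\cong\begin{cases}\mathbb{R}&k=0,\\ \mathbb{R}^2&k=1,\\ \mathbb{R}&k=2,\\ 0&\text{otherwise.}\end{cases}$$ -/

import Mathlib

noncomputable section


/-! ### The complex of alternating forms of a Lie-Rinehart algebra over the reals -/

namespace LieRinehartForms

variable (A L : Type*) [CommRing A] [LieRing L] [Module A L] [LieRingModule L A]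
  [LieRinehartRing A L] [Algebra ℝ A] [LieAlgebra ℝ L] [LieRinehartAlgebra ℝ A L]

/-- Forms of degree `p`: alternating `A`-multilinear maps `L × ⋯ × L → A`. If `A = C^∞(M)` and `L`
is the module of sections of a vector bundle, these are the sections of the `p`-th exterior power
of the dual bundle. -/
abbrev Form (p : ℕ) : Type _ := L [⋀^Fin p]→ₗ[A] A

variable {A L}

/-- `∑_i (-1)^i V_i(ω(V_0, …, V̂_i, …, V_p))`. -/
def anchorTerm {p : ℕ} (ω : Form A L p) (V : Fin (p + 1) → L) : A :=
  ∑ i : Fin (p + 1), (-1 : ℤ) ^ (i : ℕ) • ⁅V i, ω (i.removeNth V)⁆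

/-- `∑_{a < b} (-1)^(a + b) ω([V_a, V_b], V_0, …, V̂_a, …, V̂_b, …, V_p)`, which is an empty sum
for `p = 0`. The pairs `a < b` of indices in `{0, …, p + 1}` are written as `a = i`, `b = j + 1`
with `i ≤ j` in `{0, …, p}`; once `V_a` is removed, `V_b` is the entry with index `j`. -/
def bracketTerm : {p : ℕ} → Form A L p → (Fin (p + 1) → L) → A
  | 0, _, _ => 0
  | p + 1, ω, V => ∑ i : Fin (p + 1), ∑ j ≥ i, (-1 : ℤ) ^ ((i : ℕ) + ((j : ℕ) + 1)) •
      ω (Matrix.vecCons ⁅V i.castSucc, V j.succ⁆ (j.removeNth (i.castSucc.removeNth V)))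

/-- The value of `dω` on `(V_0, …, V_p)`. -/
def koszul {p : ℕ} (ω : Form A L p) (V : Fin (p + 1) → L) : A :=
  anchorTerm ω V + bracketTerm ω V

/-! The next declarations only serve to check that `koszul ω` is a form again: it is
written as a real alternating map, and then shown to be `A`-homogeneous. -/

/-- A form as a real alternating map. -/
def realForm {p : ℕ} (ω : Form A L p) : L [⋀^Fin p]→ₗ[ℝ] A :=
  { ω.toMultilinearMap.restrictScalars ℝ with map_eq_zero_of_eq' := ω.map_eq_zero_of_eq' }

lemma realForm_apply {p : ℕ} (ω : Form A L p) (V : Fin p → L) : realForm ω V = ω V := rfl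

/-- `anchorTerm ω` as a real alternating map. -/
def realAnchor {p : ℕ} (ω : Form A L p) : L [⋀^Fin (p + 1)]→ₗ[ℝ] A :=
  AlternatingMap.alternatizeUncurryFin
    { toFun := fun X => (LieModule.toEnd ℝ L A X).compAlternatingMap (realForm ω)
      map_add' := fun X Y => by ext; simp
      map_smul' := fun c X => by ext; simp }

lemma realAnchor_apply {p : ℕ} (ω : Form A L p) (V : Fin (p + 1) → L) :
    realAnchor ω V = anchorTerm ω V := by
  simp [realAnchor, anchorTerm, realForm_apply, AlternatingMap.alternatizeUncurryFin_apply]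

/-- `(X, Y) ↦ ω([X, Y], ⋯)` with values in real alternating maps. -/
def realBracketAux {p : ℕ} (ω : Form A L (p + 1)) : L →ₗ[ℝ] L →ₗ[ℝ] L [⋀^Fin p]→ₗ[ℝ] A :=
  LinearMap.mk₂ ℝ (fun X Y => (realForm ω).curryLeft ⁅X, Y⁆)
    (by intros; simp) (by intros; simp) (by intros; simp) (by intros; simp)

lemma realBracketAux_apply {p : ℕ} (ω : Form A L (p + 1)) (X Y : L) (v : Fin p → L) :
    realBracketAux ω X Y v = ω (Matrix.vecCons ⁅X, Y⁆ v) := rfl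

/-- `bracketTerm ω` as a real alternating map. -/
def realBracket : {p : ℕ} → Form A L p → L [⋀^Fin (p + 1)]→ₗ[ℝ] A
  | 0, _ => 0
  | _ + 1, ω => (-(1 / 2) : ℝ) • AlternatingMap.alternatizeUncurryFin
      (AlternatingMap.alternatizeUncurryFinLM ∘ₗ realBracketAux ω)

lemma map_cons_neg {p : ℕ} (ω : Form A L (p + 1)) (X : L) (v : Fin p → L) :
    ω (Matrix.vecCons (-X) v) = - ω (Matrix.vecCons X v) := by
  have := (ω.curryLeft).map_neg X
  exact congrArg (fun f => f v) this

lemma realBracket_apply {p : ℕ} (ω : Form A L p) (V : Fin (p + 1) → L) :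
    realBracket ω V = bracketTerm ω V := by
  cases p with
  | zero => rfl
  | succ p =>
    simp only [realBracket, bracketTerm, AlternatingMap.smul_apply,
      AlternatingMap.alternatizeUncurryFin_alternatizeUncurryFinLM_comp_apply, Finset.smul_sum]
    refine Finset.sum_congr rfl fun i _ => Finset.sum_congr rfl fun j _ => ?_
    rw [realBracketAux_apply, realBracketAux_apply, ← lie_skew (V i.castSucc) (V j.succ),
      map_cons_neg, smul_comm, ← add_assoc, pow_succ, mul_smul]
    congr 1
    module

lemma koszul_eq {p : ℕ} (ω : Form A L p) :
    koszul ω = ⇑(realAnchor ω + realBracket ω) := by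
  funext V
  simp [koszul, realAnchor_apply, realBracket_apply]

lemma map_cons_smul {p : ℕ} (ω : Form A L (p + 1)) (a : A) (X : L) (v : Fin p → L) :
    ω (Matrix.vecCons (a • X) v) = a * ω (Matrix.vecCons X v) := by
  have := (ω.curryLeft).map_smul a X
  exact congrArg (fun f => f v) this

lemma map_cons_add {p : ℕ} (ω : Form A L (p + 1)) (X Y : L) (v : Fin p → L) :
    ω (Matrix.vecCons (X + Y) v) = ω (Matrix.vecCons X v) + ω (Matrix.vecCons Y v) := by
  have := (ω.curryLeft).map_add X Y
  exact congrArg (fun f => f v) this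

lemma map_cons_cons_smul {p : ℕ} (ω : Form A L (p + 2)) (a : A) (X Y : L) (v : Fin p → L) :
    ω (Matrix.vecCons Y (Matrix.vecCons (a • X) v)) =
      a * ω (Matrix.vecCons Y (Matrix.vecCons X v)) :=
  map_cons_smul (ω.curryLeft Y) a X v

lemma removeNth_succ_cons {p : ℕ} (k : Fin (p + 1)) (X : L) (v : Fin (p + 1) → L) :
    k.succ.removeNth (Matrix.vecCons X v : Fin (p + 2) → L) =
      Matrix.vecCons X (k.removeNth v) := by
  funext t
  refine Fin.cases ?_ (fun t => ?_) t <;> simp [Fin.removeNth_apply]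

lemma removeNth_zero_cons {p : ℕ} (X : L) (v : Fin p → L) :
    (0 : Fin (p + 1)).removeNth (Matrix.vecCons X v : Fin (p + 1) → L) = v := by
  funext t
  simp [Fin.removeNth_apply]

lemma anchorTerm_cons {p : ℕ} (ω : Form A L (p + 1)) (X : L) (v : Fin (p + 1) → L) :
    anchorTerm ω (Matrix.vecCons X v) = ⁅X, ω v⁆ -
      ∑ k : Fin (p + 1), (-1 : ℤ) ^ (k : ℕ) • ⁅v k, ω (Matrix.vecCons X (k.removeNth v))⁆ := by
  rw [anchorTerm, Fin.sum_univ_succ, sub_eq_add_neg, ← Finset.sum_neg_distrib]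
  simp only [removeNth_succ_cons, removeNth_zero_cons]
  simp [pow_succ]

lemma koszul_cons_smul {p : ℕ} (ω : Form A L p) (a : A) (X : L) (v : Fin p → L) :
    koszul ω (Matrix.vecCons (a • X) v) = a * koszul ω (Matrix.vecCons X v) := by
  cases p with
  | zero => simp [koszul, anchorTerm, bracketTerm, removeNth_zero_cons]
  | succ p =>
    have hB (Y : L) : bracketTerm ω (Matrix.vecCons Y v) =
        (∑ j : Fin (p + 1), (-1 : ℤ) ^ ((j : ℕ) + 1) •
          ω (Matrix.vecCons ⁅Y, v j⁆ (j.removeNth v))) +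
        (bracketTerm ω (Matrix.vecCons Y v) - ∑ j : Fin (p + 1), (-1 : ℤ) ^ ((j : ℕ) + 1) •
          ω (Matrix.vecCons ⁅Y, v j⁆ (j.removeNth v))) := by abel
    have hR : bracketTerm ω (Matrix.vecCons (a • X) v) -
          ∑ j : Fin (p + 1), (-1 : ℤ) ^ ((j : ℕ) + 1) •
            ω (Matrix.vecCons ⁅a • X, v j⁆ (j.removeNth v)) =
        a * (bracketTerm ω (Matrix.vecCons X v) -
          ∑ j : Fin (p + 1), (-1 : ℤ) ^ ((j : ℕ) + 1) •
            ω (Matrix.vecCons ⁅X, v j⁆ (j.removeNth v))) := by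
      have h0 (Y : L) : bracketTerm ω (Matrix.vecCons Y v) -
          ∑ j : Fin (p + 1), (-1 : ℤ) ^ ((j : ℕ) + 1) •
            ω (Matrix.vecCons ⁅Y, v j⁆ (j.removeNth v)) =
          ∑ i : Fin p, ∑ j ≥ i.succ, (-1 : ℤ) ^ (((i.succ : Fin (p + 1)) : ℕ) + ((j : ℕ) + 1)) •
            ω (Matrix.vecCons ⁅v i.castSucc, v j⁆
              (j.removeNth (i.succ.castSucc.removeNth (Matrix.vecCons Y v)))) := by
        rw [bracketTerm, Fin.sum_univ_succ, sub_eq_iff_eq_add']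
        congr 1
        refine Finset.sum_congr (by ext; simp) fun j _ => ?_
        simp [removeNth_zero_cons]
      rw [h0, h0, Finset.mul_sum]
      refine Finset.sum_congr rfl fun i _ => ?_
      rw [Finset.mul_sum]
      refine Finset.sum_congr rfl fun j hj => ?_
      obtain ⟨q, rfl⟩ : ∃ q, p = q + 1 := ⟨p - 1, by have := i.pos; omega⟩
      obtain ⟨j, rfl⟩ : ∃ j', j = Fin.succ j' := ⟨j.pred (by
        rintro rfl; simp at hj), by simp⟩
      rw [← Fin.succ_castSucc, removeNth_succ_cons, removeNth_succ_cons, removeNth_succ_cons,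
        removeNth_succ_cons, map_cons_cons_smul, mul_smul_comm]
    have hS : (∑ j : Fin (p + 1), (-1 : ℤ) ^ ((j : ℕ) + 1) •
          ω (Matrix.vecCons ⁅a • X, v j⁆ (j.removeNth v))) =
        a * (∑ j : Fin (p + 1), (-1 : ℤ) ^ ((j : ℕ) + 1) •
          ω (Matrix.vecCons ⁅X, v j⁆ (j.removeNth v))) +
        ∑ k : Fin (p + 1), (-1 : ℤ) ^ (k : ℕ) •
          (⁅v k, a⁆ * ω (Matrix.vecCons X (k.removeNth v))) := by
      rw [Finset.mul_sum, ← Finset.sum_add_distrib]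
      refine Finset.sum_congr rfl fun j _ => ?_
      rw [← lie_skew (a • X), LieRinehartRing.leibniz_smul_right, map_cons_neg, map_cons_add,
        map_cons_smul, map_cons_smul, ← lie_skew (v j) X, map_cons_neg, pow_succ]
      simp only [mul_neg, mul_one, neg_smul, mul_smul_comm, smul_neg, smul_add]
      ring
    rw [koszul, koszul, hB (a • X), hB X, hR, hS, anchorTerm_cons, anchorTerm_cons]
    have hT : (∑ k : Fin (p + 1), (-1 : ℤ) ^ (k : ℕ) •
          ⁅v k, ω (Matrix.vecCons (a • X) (k.removeNth v))⁆) =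
        a * (∑ k : Fin (p + 1), (-1 : ℤ) ^ (k : ℕ) •
          ⁅v k, ω (Matrix.vecCons X (k.removeNth v))⁆) +
        ∑ k : Fin (p + 1), (-1 : ℤ) ^ (k : ℕ) •
          (⁅v k, a⁆ * ω (Matrix.vecCons X (k.removeNth v))) := by
      rw [Finset.mul_sum, ← Finset.sum_add_distrib]
      refine Finset.sum_congr rfl fun k _ => ?_
      rw [map_cons_smul, LieRinehartRing.leibniz_mul_right, smul_add, smul_eq_mul, mul_smul_comm]
    rw [hT, LieRinehartRing.lie_smul_eq_mul]
    ring

lemma koszul_update_smul {p : ℕ} (ω : Form A L p) (V : Fin (p + 1) → L) (i : Fin (p + 1))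
    (a : A) (X : L) :
    koszul ω (Function.update V i (a • X)) = a * koszul ω (Function.update V i X) := by
  have h (Y : L) : koszul ω (Function.update V i Y) =
      (-1) ^ (i : ℕ) • koszul ω (Matrix.vecCons Y (i.removeNth V)) := by
    rw [koszul_eq, ← Fin.insertNth_removeNth, AlternatingMap.map_insertNth]
  rw [h, h, koszul_cons_smul, mul_smul_comm]

/-- The differential on forms, with
`dω(V_0, …, V_p) = ∑_i (-1)^i V_i(ω(V_0, …, V̂_i, …, V_p))
  + ∑_{i < j} (-1)^(i + j) ω([V_i, V_j], V_0, …, V̂_i, …, V̂_j, …, V_p)`. -/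
def d (p : ℕ) : Form A L p →ₗ[ℝ] Form A L (p + 1) where
  toFun ω :=
    { toFun := koszul ω
      map_update_add' := fun V i X Y => by
        rw [koszul_eq]
        exact (realAnchor ω + realBracket ω).map_update_add V i X Y
      map_update_smul' := fun {inst} V i a X => by
        rw [Subsingleton.elim inst (instDecidableEqFin _)]
        exact koszul_update_smul ω V i a X
      map_eq_zero_of_eq' := fun V i j h hij => by
        rw [koszul_eq]
        exact (realAnchor ω + realBracket ω).map_eq_zero_of_eq V h hij }
  map_add' ω η := by
    ext V
    change koszul (ω + η) V = koszul ω V + koszul η V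
    have hB : bracketTerm (ω + η) V = bracketTerm ω V + bracketTerm η V := by
      cases p <;> simp [bracketTerm, Finset.sum_add_distrib]
    simp only [koszul, hB, anchorTerm, AlternatingMap.add_apply, lie_add, smul_add,
      Finset.sum_add_distrib]
    abel
  map_smul' c ω := by
    ext V
    change koszul (c • ω) V = c • koszul ω V
    have hB : bracketTerm (c • ω) V = c • bracketTerm ω V := by
      cases p <;> simp [bracketTerm, Finset.smul_sum, smul_comm c]
    simp only [koszul, hB, anchorTerm, AlternatingMap.smul_apply, lie_smul, smul_add,
      Finset.smul_sum, smul_comm c]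

variable (A L)

instance (p : ℕ) : AddCommGroup (Form A L p) := AlternatingMap.instAddCommGroup

/-- Closed forms of degree `p`. -/
def closedForms (p : ℕ) : Submodule ℝ (Form A L p) := LinearMap.ker (d p)

/-- Exact forms of degree `p`; only `0` is exact in degree `0`. -/
def exactForms : (p : ℕ) → Submodule ℝ (Form A L p)
  | 0 => ⊥
  | p + 1 => LinearMap.range (d p)

/-- The cohomology in degree `p`: closed forms modulo exact forms. -/
abbrev Cohomology (p : ℕ) : Type _ :=
  closedForms A L p ⧸ (exactForms A L p).submoduleOf (closedForms A L p)

end LieRinehartForms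

/-! ### Smooth functions and vector fields on the plane -/

namespace EllipticPlane

open scoped Manifold ContDiff

open VectorField

/-- The plane `ℝ²`; the coordinates of a point `q` are `x = q 0` and `y = q 1`. -/
abbrev Plane : Type := EuclideanSpace ℝ (Fin 2)

/-- The algebra `C^∞(ℝ²)`. -/
abbrev SmoothFun : Type := C^∞⟮𝓘(ℝ, Plane), Plane; 𝓘(ℝ, ℝ), ℝ⟯

/-- The `C^∞(ℝ²)`-module `Vect(ℝ²)` of smooth vector fields, with pointwise operations. -/
abbrev Vect : Type := C^∞⟮𝓘(ℝ, Plane), Plane; 𝓘(ℝ, Plane), Plane⟯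

lemma SmoothFun.contDiff (f : SmoothFun) : ContDiff ℝ ∞ (f : Plane → ℝ) :=
  contMDiff_iff_contDiff.1 f.contMDiff

lemma Vect.contDiff (V : Vect) : ContDiff ℝ ∞ (V : Plane → Plane) :=
  contMDiff_iff_contDiff.1 V.contMDiff

lemma SmoothFun.differentiableAt (f : SmoothFun) (q : Plane) :
    DifferentiableAt ℝ (f : Plane → ℝ) q :=
  (SmoothFun.contDiff f).differentiable (by simp) q

lemma Vect.differentiableAt (V : Vect) (q : Plane) :
    DifferentiableAt ℝ (V : Plane → Plane) q :=
  (Vect.contDiff V).differentiable (by simp) q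

lemma minSmoothness_two_le : minSmoothness ℝ 2 ≤ ∞ := by
  rw [minSmoothness_of_isRCLikeNormedField]
  exact WithTop.coe_le_coe.2 le_top

/-- The Lie bracket of vector fields. -/
instance : Bracket Vect Vect where
  bracket V W := ⟨lieBracket ℝ V W, contMDiff_iff_contDiff.2
    ((Vect.contDiff V).lieBracket_vectorField (Vect.contDiff W) (by simp))⟩

lemma lie_apply (V W : Vect) (q : Plane) : ⁅V, W⁆ q = lieBracket ℝ V W q := rfl

/-- The derivative `V(f)` of a function along a vector field. -/
instance : Bracket Vect SmoothFun where
  bracket V f := ⟨fun q => fderiv ℝ f q (V q), contMDiff_iff_contDiff.2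
    (((SmoothFun.contDiff f).fderiv_right (m := ∞) (by simp)).clm_apply (Vect.contDiff V))⟩

lemma lie_fun_apply (V : Vect) (f : SmoothFun) (q : Plane) : ⁅V, f⁆ q = fderiv ℝ f q (V q) := rfl

instance : LieRing Vect where
  add_lie U V W := by
    ext1 q
    exact lieBracket_add_left (Vect.differentiableAt U q) (Vect.differentiableAt V q)
  lie_add U V W := by
    ext1 q
    exact lieBracket_add_right (Vect.differentiableAt V q) (Vect.differentiableAt W q)
  lie_self U := by
    ext1 q
    exact congrFun (lieBracket_self (𝕜 := ℝ) (V := (U : Plane → Plane))) q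
  leibniz_lie U V W := by
    ext1 q
    exact leibniz_identity_lieBracket (n := ∞) minSmoothness_two_le (Vect.contDiff U).contDiffAt
      (Vect.contDiff V).contDiffAt (Vect.contDiff W).contDiffAt

instance : LieAlgebra ℝ Vect where
  lie_smul c V W := by
    ext1 q
    exact lieBracket_const_smul_right (Vect.differentiableAt W q)

instance : LieRingModule Vect SmoothFun where
  add_lie V W f := by
    ext1 q
    exact map_add (fderiv ℝ f q) (V q) (W q)
  lie_add V f g := by
    ext1 q
    change fderiv ℝ (⇑f + ⇑g) q (V q) = fderiv ℝ f q (V q) + fderiv ℝ g q (V q)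
    rw [fderiv_add (SmoothFun.differentiableAt f q) (SmoothFun.differentiableAt g q)]
    rfl
  leibniz_lie V W f := by
    ext1 q
    have h := fderiv_apply_lieBracket (𝕜 := ℝ) (n := ∞) (x := q)
      (SmoothFun.contDiff f).contDiffAt minSmoothness_two_le
      (Vect.differentiableAt W q) (Vect.differentiableAt V q)
    change fderiv ℝ (fun r => fderiv ℝ f r (W r)) q (V q) =
      fderiv ℝ f q (lieBracket ℝ V W q) + fderiv ℝ (fun r => fderiv ℝ f r (V r)) q (W q)
    rw [h]
    abel

instance : LieRinehartRing SmoothFun Vect where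
  lie_smul_eq_mul' a b V := by
    ext1 q
    exact map_smul (fderiv ℝ b q) (a q) (V q)
  leibniz_mul_right' V a b := by
    ext1 q
    change fderiv ℝ (⇑a * ⇑b) q (V q) = a q * fderiv ℝ b q (V q) + fderiv ℝ a q (V q) * b q
    rw [fderiv_mul (SmoothFun.differentiableAt a q) (SmoothFun.differentiableAt b q)]
    simp [mul_comm]
  leibniz_smul_right' V W a := by
    ext1 q
    change lieBracket ℝ V (fun r => a r • W r) q =
      a q • lieBracket ℝ V W q + fderiv ℝ a q (V q) • W q
    rw [lieBracket_smul_right (SmoothFun.differentiableAt a q) (Vect.differentiableAt W q)]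
    abel

instance : LieRinehartAlgebra ℝ SmoothFun Vect where
  smul_assoc c a V := by
    ext1 q
    exact smul_assoc c (a q) (V q)
  smul_lie c V f := by
    ext1 q
    exact map_smul (fderiv ℝ f q) c (V q)
  lie_smul c V f := by
    ext1 q
    change fderiv ℝ (c • ⇑f) q (V q) = c • fderiv ℝ f q (V q)
    rw [fderiv_const_smul (SmoothFun.differentiableAt f q)]
    rfl

/-! ### The elliptic structure -/

/-- The dilation `x ∂/∂x + y ∂/∂y`. -/
def v₁ : Vect := ⟨fun q => !₂[q 0, q 1], contMDiff_iff_contDiff.2 (by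
  rw [contDiff_euclidean]; intro i; fin_cases i <;> simp <;> fun_prop)⟩

/-- The rotation `-y ∂/∂x + x ∂/∂y`. -/
def v₂ : Vect := ⟨fun q => !₂[-q 1, q 0], contMDiff_iff_contDiff.2 (by
  rw [contDiff_euclidean]; intro i; fin_cases i <;> simp <;> fun_prop)⟩

lemma lie_v₁_v₂ : ⁅v₁, v₂⁆ = 0 := by
  let J : Plane →ₗ[ℝ] Plane :=
    { toFun := fun q => !₂[-q 1, q 0]
      map_add' := fun q r => by ext i; fin_cases i <;> simp [add_comm]
      map_smul' := fun c q => by ext i; fin_cases i <;> simp }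
  have h₁ : (v₁ : Plane → Plane) = id := by
    funext q; ext i; fin_cases i <;> rfl
  have h₂ : (v₂ : Plane → Plane) = LinearMap.toContinuousLinearMap J := rfl
  ext1 q
  rw [lie_apply, lieBracket, h₁, h₂, fderiv_id, ContinuousLinearMap.fderiv]
  exact sub_self _

/-- The `C^∞(ℝ²)`-submodule of `Vect(ℝ²)` generated by `v₁` and `v₂`, which is involutive. -/
def E : LieRinehartSubalgebra SmoothFun Vect where
  toSubmodule := Submodule.span SmoothFun {v₁, v₂}
  lie_mem' {V W} hV hW := by
    have hS (X Y : Vect) (a : SmoothFun) (hY : Y ∈ Submodule.span SmoothFun {v₁, v₂})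
        (hXY : ⁅X, Y⁆ ∈ Submodule.span SmoothFun {v₁, v₂}) :
        ⁅X, a • Y⁆ ∈ Submodule.span SmoothFun {v₁, v₂} := by
      rw [LieRinehartRing.leibniz_smul_right]
      exact add_mem (Submodule.smul_mem _ _ hXY) (Submodule.smul_mem _ _ hY)
    have h₁ : v₁ ∈ Submodule.span SmoothFun {v₁, v₂} := Submodule.subset_span (by simp)
    have h₂ : v₂ ∈ Submodule.span SmoothFun {v₁, v₂} := Submodule.subset_span (by simp)
    have h₂₁ : ⁅v₂, v₁⁆ = 0 := by rw [← lie_skew, lie_v₁_v₂, neg_zero]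
    have hG (X : Vect) (hX₁ : ⁅X, v₁⁆ ∈ Submodule.span SmoothFun {v₁, v₂})
        (hX₂ : ⁅X, v₂⁆ ∈ Submodule.span SmoothFun {v₁, v₂}) (Y : Vect)
        (hY : Y ∈ Submodule.span SmoothFun {v₁, v₂}) :
        ⁅X, Y⁆ ∈ Submodule.span SmoothFun {v₁, v₂} := by
      obtain ⟨a, b, rfl⟩ := Submodule.mem_span_pair.1 hY
      rw [lie_add]
      exact add_mem (hS X v₁ a h₁ hX₁) (hS X v₂ b h₂ hX₂)
    refine hG V ?_ ?_ W hW
    · rw [← lie_skew]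
      exact neg_mem (hG v₁ (by simp) (by simp [lie_v₁_v₂]) V hV)
    · rw [← lie_skew]
      exact neg_mem (hG v₂ (by simp [h₂₁]) (by simp) V hV)

/-- The `E`-cohomology of the plane. As `E` is free on `v₁` and `v₂`, the alternating
`C^∞(ℝ²)`-multilinear maps `E × ⋯ × E → C^∞(ℝ²)` of degree `k` are exactly the global sections of
the `k`-th exterior power of the `E`-cotangent bundle. -/
abbrev ECohomology (k : ℕ) : Type := LieRinehartForms.Cohomology SmoothFun E k

end EllipticPlane
end


/-!
A class is determined by the values at the origin of the components of a representative along
`v₁` and `v₂`. Indeed, the Euler field `v₁` annihilates only the constants, and every smooth `f`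
with `f(0) = 0` is `v₁(g)` for a smooth `g`: Hadamard's lemma writes `f(x) = K(x) x`, and averaging
`K` along rays inverts `K ↦ K + DK(x) x`. As `v₁` and `v₂` commute, in terms of components the
differential is `f ↦ (v₁ f, v₂ f)` and `(a, b) ↦ v₁ b - v₂ a`. Exact forms thus have components
vanishing at the origin. Conversely, a 2-form with `c(0) = 0` is hit by `(0, b)` with `v₁ b = c`,
and for a closed 1-form with `a(0) = b(0) = 0` a solution of `v₁ f = a` also has `v₂ f = b`, since
`v₂ f - b` is annihilated by `v₁` and vanishes at the origin.
-/

section RadialCalculus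

open scoped ContDiff

variable {H G : Type*} [NormedAddCommGroup H] [NormedSpace ℝ H] [NormedAddCommGroup G]
  [NormedSpace ℝ G]

section ParametricIntegral

variable [FiniteDimensional ℝ H]

lemma hasFDerivAt_intervalIntegral_of_contDiff {F : H → ℝ → G}
    (hF : ContDiff ℝ 1 (Function.uncurry F)) (a b : ℝ) (x : H) :
    HasFDerivAt (fun y => ∫ t in a..b, F y t)
      (∫ t in a..b, (fderiv ℝ (Function.uncurry F) (x, t)).comp (.inl ℝ H ℝ)) x := by
  have hF' : Continuous fun p : H × ℝ =>
      (fderiv ℝ (Function.uncurry F) p).comp (ContinuousLinearMap.inl ℝ H ℝ) :=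
    (hF.continuous_fderiv one_ne_zero).clm_comp continuous_const
  have hF_cont (y : H) : Continuous (F y) := hF.continuous.comp (Continuous.prodMk_right y)
  obtain ⟨C, hC⟩ := ((isCompact_closedBall x 1).prod
    (isCompact_uIcc (a := a) (b := b))).exists_bound_of_continuousOn hF'.continuousOn
  exact intervalIntegral.hasFDerivAt_integral_of_dominated_of_fderiv_le
    (F' := fun y t => (fderiv ℝ (Function.uncurry F) (y, t)).comp (.inl ℝ H ℝ))
    (bound := fun _ => C)
    (Metric.closedBall_mem_nhds x one_pos)
    (.of_forall fun y => (hF_cont y).aestronglyMeasurable)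
    ((hF_cont x).intervalIntegrable a b)
    (hF'.comp (Continuous.prodMk_right x)).aestronglyMeasurable
    (.of_forall fun t ht y hy => hC (y, t) ⟨hy, Set.uIoc_subset_uIcc ht⟩)
    intervalIntegrable_const
    (.of_forall fun t _ y _ => HasFDerivAt.comp (f := fun z => (z, t)) y
      (hF.differentiable one_ne_zero (y, t)).hasFDerivAt (hasFDerivAt_prodMk_left y t))

lemma contDiff_intervalIntegral {n : ℕ∞} {F : H → ℝ → G}
    (hF : ContDiff ℝ n (Function.uncurry F)) (a b : ℝ) :
    ContDiff ℝ n fun x => ∫ t in a..b, F x t := by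
  suffices h : ∀ (m : ℕ) {F : H → ℝ → G}, ContDiff ℝ m (Function.uncurry F) →
      ContDiff ℝ m fun x => ∫ t in a..b, F x t from
    contDiff_iff_forall_nat_le.2 fun m hm => h m (hF.of_le (by exact_mod_cast hm))
  intro m
  induction m with
  | zero =>
    intro F hF
    exact contDiff_zero.2 (intervalIntegral.continuous_parametric_intervalIntegral_of_continuous
      hF.continuous continuous_const)
  | succ m ih =>
    intro F hF
    have hderiv := hasFDerivAt_intervalIntegral_of_contDiff (hF.of_le (by norm_cast; omega)) a b
    push_cast at hF ⊢
    have hF' : ContDiff ℝ m (fderiv ℝ (Function.uncurry F)) := hF.fderiv_right le_rfl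
    -- Applying the derivative to a fixed vector keeps the values in `G`, as the induction needs.
    refine contDiff_succ_iff_fderiv_apply.2
      ⟨fun x => (hderiv x).differentiableAt, by simp, fun y => ?_⟩
    have hderiv_apply (x : H) : fderiv ℝ (fun z => ∫ t in a..b, F z t) x y =
        ∫ t in a..b, fderiv ℝ (Function.uncurry F) (x, t) (y, 0) := by
      rw [(hderiv x).fderiv, ContinuousLinearMap.intervalIntegral_apply]
      · rfl
      · exact ((hF'.continuous.comp (Continuous.prodMk_right x)).clm_comp
          continuous_const).intervalIntegrable a b
    simp only [hderiv_apply]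
    exact ih (F := fun x t => fderiv ℝ (Function.uncurry F) (x, t) (y, 0))
      (hF'.clm_apply contDiff_const)

end ParametricIntegral

/-- The average of a function over the segment from the origin to `x`, which turns a derivative into
a difference quotient (Hadamard's lemma) and inverts `f ↦ f + Df(x) x`. -/
noncomputable def rayAverage (g : H → G) (x : H) : G :=
  ∫ t in (0 : ℝ)..1, g (t • x)

lemma hasDerivAt_comp_smul {f : H → G} {x : H} {t : ℝ} (hf : DifferentiableAt ℝ f (t • x)) :
    HasDerivAt (fun s : ℝ => f (s • x)) (fderiv ℝ f (t • x) x) t := by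
  have hline : HasDerivAt (fun s : ℝ => s • x) x t := by
    simpa using (hasDerivAt_id t).smul_const x
  exact hf.hasFDerivAt.comp_hasDerivAt t hline

lemma eq_apply_zero_of_fderiv_apply_self_eq_zero {f : H → G} (hf : Differentiable ℝ f)
    (h : ∀ x, fderiv ℝ f x x = 0) (x : H) : f x = f 0 := by
  have hray {t : ℝ} (ht : t ≠ 0) : fderiv ℝ f (t • x) x = 0 := by
    simpa [ht] using h (t • x)
  -- The segment is run from `x` to `0`, as `hray` says nothing about the derivative at `t = 0`.
  have hconst := constant_of_has_deriv_right_zero (f := fun s : ℝ => f ((1 - s) • x)) (a := 0)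
    (b := 1) (hf.continuous.comp (by fun_prop)).continuousOn fun s hs => by
      have := (hasDerivAt_comp_smul (x := x) (hf ((1 - s) • x))).scomp s
        ((hasDerivAt_id' s).const_sub 1)
      rw [hray (sub_pos.2 hs.2).ne', smul_zero] at this
      exact this.hasDerivWithinAt
  simpa using (hconst 1 (by simp)).symm

lemma contDiff_rayAverage [FiniteDimensional ℝ H] {n : ℕ∞} {g : H → G} (hg : ContDiff ℝ n g) :
    ContDiff ℝ n (rayAverage g) :=
  contDiff_intervalIntegral (F := fun x t => g (t • x))
    (hg.comp (contDiff_snd.smul contDiff_fst)) 0 1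

lemma smul_rayAverage_smul (g : H → G) (s : ℝ) (x : H) :
    s • rayAverage g (s • x) = ∫ t in (0 : ℝ)..s, g (t • x) := by
  have := intervalIntegral.smul_integral_comp_mul_right (a := 0) (b := 1) (fun t => g (t • x)) s
  simpa only [rayAverage, mul_smul, zero_mul, one_mul] using this

variable [CompleteSpace G]

lemma rayAverage_fderiv_apply_self {f : H → G} (hf : ContDiff ℝ 1 f) (x : H) :
    rayAverage (fderiv ℝ f) x x = f x - f 0 := by
  have hcont : Continuous fun t : ℝ => fderiv ℝ f (t • x) :=
    (hf.continuous_fderiv one_ne_zero).comp (by fun_prop)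
  calc rayAverage (fderiv ℝ f) x x = ∫ t in (0 : ℝ)..1, fderiv ℝ f (t • x) x :=
        ContinuousLinearMap.intervalIntegral_apply (hcont.intervalIntegrable 0 1) x
    _ = f ((1 : ℝ) • x) - f ((0 : ℝ) • x) :=
        intervalIntegral.integral_eq_sub_of_hasDerivAt
          (fun t _ => hasDerivAt_comp_smul (hf.differentiable one_ne_zero _))
          ((hcont.clm_apply continuous_const).intervalIntegrable 0 1)
    _ = f x - f 0 := by rw [one_smul, zero_smul]

lemma fderiv_rayAverage_apply_self_add [FiniteDimensional ℝ H] {g : H → G} (hg : ContDiff ℝ 1 g)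
    (x : H) : fderiv ℝ (rayAverage g) x x + rayAverage g x = g x := by
  have hcont : Continuous fun t : ℝ => g (t • x) := hg.continuous.comp (by fun_prop)
  have hprod : HasDerivAt (fun s : ℝ => s • rayAverage g (s • x))
      (fderiv ℝ (rayAverage g) x x + rayAverage g x) 1 := by
    simpa using (hasDerivAt_id' (1 : ℝ)).fun_smul
      (hasDerivAt_comp_smul ((contDiff_rayAverage hg).differentiable one_ne_zero ((1 : ℝ) • x)))
  have hint : HasDerivAt (fun s : ℝ => s • rayAverage g (s • x)) (g x) 1 := by
    simpa only [smul_rayAverage_smul, one_smul] using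
      intervalIntegral.integral_hasDerivAt_right (hcont.intervalIntegrable 0 1)
        (hcont.stronglyMeasurableAtFilter _ _) hcont.continuousAt
  exact hprod.unique hint

lemma exists_contDiff_fderiv_apply_self_eq [FiniteDimensional ℝ H] {f : H → G}
    (hf : ContDiff ℝ ∞ f) (h0 : f 0 = 0) :
    ∃ g : H → G, ContDiff ℝ ∞ g ∧ ∀ x, fderiv ℝ g x x = f x := by
  -- Formally `g x = ∫₀¹ f (t x) / t dt`, and Hadamard's lemma `f x = K x x` removes the pole.
  set K := rayAverage (fderiv ℝ f) with hK
  have hKf (x : H) : K x x = f x := by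
    rw [hK, rayAverage_fderiv_apply_self (hf.of_le (by simp)), h0, sub_zero]
  have hK_smooth : ContDiff ℝ ∞ K := contDiff_rayAverage (n := ⊤) (hf.fderiv_right (by simp))
  have hg : ContDiff ℝ ∞ (rayAverage K) := contDiff_rayAverage (n := ⊤) hK_smooth
  refine ⟨fun x => rayAverage K x x, hg.clm_apply contDiff_id, fun x => ?_⟩
  have hleibniz : HasFDerivAt (fun y => rayAverage K y y) _ x :=
    (hg.differentiable (by simp) x).hasFDerivAt.clm_apply (hasFDerivAt_id x)
  calc fderiv ℝ (fun y => rayAverage K y y) x x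
      = (fderiv ℝ (rayAverage K) x x + rayAverage K x) x := by
        rw [hleibniz.fderiv]
        simp [add_comm]
    _ = f x := by rw [fderiv_rayAverage_apply_self_add (hK_smooth.of_le (by simp)), hKf]

end RadialCalculus

namespace LieRinehartForms

section Forms

variable {A L : Type*} [CommRing A] [LieRing L] [Module A L]

lemma form_zero_ext {ω η : Form A L 0} (h : ω ![] = η ![]) : ω = η := by
  ext V
  rwa [Subsingleton.elim V ![]]

lemma form_one_ext {ι : Type*} (e : Module.Basis ι A L) {ω η : Form A L 1}
    (h : ∀ i, ω ![e i] = η ![e i]) : ω = η :=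
  e.ext_alternating fun v _ => by
    have hv : (fun i => e (v i)) = ![e (v 0)] := funext fun i => by rw [Subsingleton.elim i 0]; rfl
    rw [hv, h]

lemma form_top_ext {n : ℕ} (e : Module.Basis (Fin n) A L) {ω η : Form A L n} (h : ω e = η e) :
    ω = η := by
  rw [ω.eq_smul_basis_det e, η.eq_smul_basis_det e, h]

lemma subsingleton_form_of_card_lt {ι : Type*} [Fintype ι] (e : Module.Basis ι A L) {p : ℕ}
    (hp : Fintype.card ι < p) : Subsingleton (Form A L p) where
  allEq ω η := e.ext_alternating fun v hv => by
    have := Fintype.card_le_of_injective v hv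
    rw [Fintype.card_fin] at this
    omega

lemma exists_form_one {ι : Type*} (e : Module.Basis ι A L) (a : ι → A) :
    ∃ ω : Form A L 1, ∀ i, ω ![e i] = a i :=
  ⟨AlternatingMap.ofSubsingleton A L A 0 (e.constr ℕ a), fun i => by simp⟩

lemma exists_form_top {n : ℕ} (e : Module.Basis (Fin n) A L) (a : A) :
    ∃ ω : Form A L n, ω e = a :=
  ⟨a • e.det, by simp [e.det_self]⟩

variable [Algebra ℝ A]

/-- The linear functional `ω ↦ ε(ω(V))` on forms. Applied to a basis, it reads off the coefficients
that survive in cohomology. -/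
def evalOn (ε : A →ₗ[ℝ] ℝ) {p : ℕ} (V : Fin p → L) : Form A L p →ₗ[ℝ] ℝ where
  toFun ω := ε (ω V)
  map_add' _ _ := by simp
  map_smul' _ _ := by simp

lemma evalOn_apply (ε : A →ₗ[ℝ] ℝ) {p : ℕ} (V : Fin p → L) (ω : Form A L p) :
    evalOn ε V ω = ε (ω V) := rfl

end Forms

section IsEulerLike

variable {A L : Type*} [CommRing A] [Algebra ℝ A] [LieRing L] [LieRingModule L A]

/-- `X` is Euler-like with respect to `ε` if `0 → ℝ → A → A → ℝ → 0`, with middle map `a ↦ X(a)` and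
last map `ε`, is exact, and `ε` is the identity on constants. This is how the Euler field
`∑ xᵢ ∂/∂xᵢ` acts on `C^∞(ℝⁿ)`, with `ε` the evaluation at the origin; since `ε` need not be
multiplicative, it also covers a Diophantine constant field on a torus, with `ε` the mean. -/
structure IsEulerLike (ε : A →ₗ[ℝ] ℝ) (X : L) : Prop where
  map_algebraMap (c : ℝ) : ε (algebraMap ℝ A c) = c
  eq_algebraMap {a : A} (ha : ⁅X, a⁆ = 0) : a = algebraMap ℝ A (ε a)
  map_lie (a : A) : ε ⁅X, a⁆ = 0
  exists_lie_eq {a : A} (ha : ε a = 0) : ∃ b : A, ⁅X, b⁆ = a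

lemma IsEulerLike.eq_zero {ε : A →ₗ[ℝ] ℝ} {X : L} (hX : IsEulerLike ε X) {a : A}
    (ha : ⁅X, a⁆ = 0) (h : ε a = 0) : a = 0 := by
  rw [hX.eq_algebraMap ha, h, map_zero]

end IsEulerLike

variable {A L : Type*} [CommRing A] [LieRing L] [Module A L] [LieRingModule L A]
  [LieRinehartRing A L] [Algebra ℝ A] [LieAlgebra ℝ L] [LieRinehartAlgebra ℝ A L]

lemma lie_algebraMap (X : L) (c : ℝ) : ⁅X, algebraMap ℝ A c⁆ = 0 := by
  simpa only [LieRinehartAlgebra.anchor_apply] using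
    (LieRinehartAlgebra.anchor ℝ A L X).map_algebraMap c

lemma d_zero_apply (ω : Form A L 0) (V : Fin 1 → L) : d 0 ω V = ⁅V 0, ω ![]⁆ := by
  change koszul ω V = _
  simp [koszul, anchorTerm, bracketTerm, Subsingleton.elim _ (![] : Fin 0 → L)]

lemma d_one_apply (ω : Form A L 1) (X Y : L) :
    d 1 ω ![X, Y] = ⁅X, ω ![Y]⁆ - ⁅Y, ω ![X]⁆ - ω ![⁅X, Y⁆] := by
  change koszul ω ![X, Y] = _
  rw [koszul, anchorTerm_cons]
  simp [bracketTerm, Subsingleton.elim _ (![] : Fin 0 → L), sub_eq_add_neg]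

lemma mem_closedForms_zero {ω : Form A L 0} :
    ω ∈ closedForms A L 0 ↔ ∀ X : L, ⁅X, ω ![]⁆ = 0 := by
  rw [closedForms, LinearMap.mem_ker]
  refine ⟨fun h X => ?_, fun h => ?_⟩
  · simpa [h] using (d_zero_apply ω ![X]).symm
  · ext V
    rw [d_zero_apply, h, AlternatingMap.zero_apply]

lemma nonempty_cohomology_equiv_of_surjective_of_ker {p : ℕ} {W : Type*} [AddCommGroup W]
    [Module ℝ W] (φ : Form A L p →ₗ[ℝ] W)
    (hsurj : ∀ w, ∃ ω ∈ closedForms A L p, φ ω = w)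
    (hker : ∀ ω ∈ closedForms A L p, φ ω = 0 ↔ ω ∈ exactForms A L p) :
    Nonempty (Cohomology A L p ≃ₗ[ℝ] W) := by
  have hs : Function.Surjective (φ.domRestrict (closedForms A L p)) := fun w => by
    obtain ⟨ω, hω, h⟩ := hsurj w
    exact ⟨⟨ω, hω⟩, h⟩
  have hk : (exactForms A L p).submoduleOf (closedForms A L p) =
      LinearMap.ker (φ.domRestrict (closedForms A L p)) := by
    ext ω
    exact (hker ω ω.2).symm
  exact ⟨(Submodule.quotEquivOfEq _ _ hk).trans (LinearMap.quotKerEquivOfSurjective _ hs)⟩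

lemma subsingleton_cohomology_of_card_lt {ι : Type*} [Fintype ι] (e : Module.Basis ι A L) {p : ℕ}
    (hp : Fintype.card ι < p) : Subsingleton (Cohomology A L p) :=
  have := subsingleton_form_of_card_lt e hp
  (Submodule.mkQ_surjective _).subsingleton

namespace IsEulerLike

variable {ε : A →ₗ[ℝ] ℝ} {X Y : L}

lemma map_lie_of_lie_eq_zero (hX : IsEulerLike ε X) (hXY : ⁅X, Y⁆ = 0) (a : A) :
    ε ⁅Y, a⁆ = 0 := by
  obtain ⟨b, hb⟩ := hX.exists_lie_eq (a := a - algebraMap ℝ A (ε a)) (by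
    rw [map_sub, hX.map_algebraMap, sub_self])
  calc ε ⁅Y, a⁆ = ε ⁅Y, ⁅X, b⁆⁆ := by rw [hb, lie_sub, lie_algebraMap, sub_zero]
    _ = ε ⁅X, ⁅Y, b⁆⁆ := by rw [leibniz_lie X Y b, hXY, zero_lie, zero_add]
    _ = 0 := hX.map_lie _

lemma nonempty_cohomology_zero_equiv (hX : IsEulerLike ε X) :
    Nonempty (Cohomology A L 0 ≃ₗ[ℝ] ℝ) := by
  refine nonempty_cohomology_equiv_of_surjective_of_ker (evalOn ε ![]) (fun c => ?_) fun ω hω => ?_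
  · exact ⟨AlternatingMap.constOfIsEmpty A L (Fin 0) (algebraMap ℝ A c),
      mem_closedForms_zero.2 fun Y => lie_algebraMap Y c, hX.map_algebraMap c⟩
  · rw [evalOn_apply, exactForms, Submodule.mem_bot]
    refine ⟨fun h => form_zero_ext ?_, fun h => by simp [h]⟩
    exact hX.eq_zero (mem_closedForms_zero.1 hω X) h

end IsEulerLike

section RankTwo

variable (e : Module.Basis (Fin 2) A L)

lemma d_one_apply_basis (he : ⁅e 0, e 1⁆ = 0) (ω : Form A L 1) :
    d 1 ω e = ⁅e 0, ω ![e 1]⁆ - ⁅e 1, ω ![e 0]⁆ := by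
  have hz : ω ![0] = 0 := ω.map_coord_zero (0 : Fin 1) rfl
  have hcons : (e : Fin 2 → L) = ![e 0, e 1] := List.ofFn_inj.1 rfl
  calc d 1 ω e = d 1 ω ![e 0, e 1] := congrArg _ hcons
    _ = ⁅e 0, ω ![e 1]⁆ - ⁅e 1, ω ![e 0]⁆ := by rw [d_one_apply, he, hz, sub_zero]

lemma mem_closedForms_one (he : ⁅e 0, e 1⁆ = 0) {ω : Form A L 1} :
    ω ∈ closedForms A L 1 ↔ ⁅e 0, ω ![e 1]⁆ = ⁅e 1, ω ![e 0]⁆ := by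
  rw [closedForms, LinearMap.mem_ker, ← sub_eq_zero (a := ⁅e 0, _⁆), ← d_one_apply_basis e he]
  exact ⟨fun h => by rw [h, AlternatingMap.zero_apply], fun h => form_top_ext e h⟩

variable {ε : A →ₗ[ℝ] ℝ}

lemma exists_d_zero_eq_of_mem_closedForms_one (he : ⁅e 0, e 1⁆ = 0) (hX : IsEulerLike ε (e 0))
    {ω : Form A L 1} (hω : ω ∈ closedForms A L 1) (h : ∀ i, ε (ω ![e i]) = 0) :
    ∃ η : Form A L 0, d 0 η = ω := by
  obtain ⟨f, hf⟩ := hX.exists_lie_eq (h 0)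
  have hf' : ⁅e 1, f⁆ = ω ![e 1] := by
    refine sub_eq_zero.1 (hX.eq_zero ?_ ?_)
    · rw [lie_sub, leibniz_lie, he, zero_lie, zero_add, hf, (mem_closedForms_one e he).1 hω,
        sub_self]
    · rw [map_sub, hX.map_lie_of_lie_eq_zero he, h 1, sub_zero]
  refine ⟨AlternatingMap.constOfIsEmpty A L (Fin 0) f, form_one_ext e fun i => ?_⟩
  rw [d_zero_apply]
  fin_cases i
  · exact hf
  · exact hf'

lemma nonempty_cohomology_one_equiv (he : ⁅e 0, e 1⁆ = 0) (hX : IsEulerLike ε (e 0)) :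
    Nonempty (Cohomology A L 1 ≃ₗ[ℝ] (Fin 2 → ℝ)) := by
  refine nonempty_cohomology_equiv_of_surjective_of_ker
    (LinearMap.pi fun i => evalOn ε ![e i]) (fun c => ?_) fun ω hω => ?_
  · obtain ⟨ω, hω⟩ := exists_form_one e fun i => algebraMap ℝ A (c i)
    refine ⟨ω, (mem_closedForms_one e he).2 (by simp only [hω, lie_algebraMap]), ?_⟩
    ext i
    rw [LinearMap.pi_apply, evalOn_apply, hω, hX.map_algebraMap]
  · refine ⟨fun h => exists_d_zero_eq_of_mem_closedForms_one e he hX hω (congrFun h), ?_⟩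
    rintro ⟨η, rfl⟩
    ext i
    rw [LinearMap.pi_apply, evalOn_apply, d_zero_apply]
    fin_cases i
    · exact hX.map_lie _
    · exact hX.map_lie_of_lie_eq_zero he _

lemma nonempty_cohomology_two_equiv (he : ⁅e 0, e 1⁆ = 0) (hX : IsEulerLike ε (e 0)) :
    Nonempty (Cohomology A L 2 ≃ₗ[ℝ] ℝ) := by
  have hclosed (ω : Form A L 2) : ω ∈ closedForms A L 2 :=
    have := subsingleton_form_of_card_lt e (p := 3) (by simp)
    LinearMap.mem_ker.2 (Subsingleton.elim _ _)
  refine nonempty_cohomology_equiv_of_surjective_of_ker (evalOn ε e) (fun c => ?_)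
    fun ω _ => ⟨fun h => ?_, ?_⟩
  · obtain ⟨ω, hω⟩ := exists_form_top e (algebraMap ℝ A c)
    exact ⟨ω, hclosed ω, by rw [evalOn_apply, hω, hX.map_algebraMap]⟩
  · obtain ⟨f, hf⟩ := hX.exists_lie_eq h
    obtain ⟨η, hη⟩ := exists_form_one e ![0, f]
    refine ⟨η, form_top_ext e ?_⟩
    rw [d_one_apply_basis e he, hη, hη]
    simpa using hf
  · rintro ⟨η, rfl⟩
    rw [evalOn_apply, d_one_apply_basis e he, map_sub, hX.map_lie,
      hX.map_lie_of_lie_eq_zero he, sub_zero]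

end RankTwo

end LieRinehartForms

namespace EllipticPlane

lemma v₁_apply (q : Plane) : v₁ q = q := by
  ext i; fin_cases i <;> rfl

lemma eq_zero_of_forall_ne_zero {f : SmoothFun} (h : ∀ q : Plane, q ≠ 0 → f q = 0) : f = 0 :=
  DFunLike.coe_injective <| Continuous.ext_on (dense_compl_singleton (0 : Plane))
    f.contDiff.continuous continuous_const h

lemma eq_zero_of_smul_add_smul_eq_zero {f g : SmoothFun} (h : f • v₁ + g • v₂ = 0) :
    f = 0 ∧ g = 0 := by
  have hq (q : Plane) : f q • v₁ q + g q • v₂ q = 0 := DFunLike.congr_fun h q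
  have h₁ (q : Plane) : f q * q 0 - g q * q 1 = 0 := by
    simpa [v₁, v₂, sub_eq_add_neg] using congrArg (· 0) (hq q)
  have h₂ (q : Plane) : f q * q 1 + g q * q 0 = 0 := by
    simpa [v₁, v₂] using congrArg (· 1) (hq q)
  have hnorm {q : Plane} (hq : q ≠ 0) : q 0 ^ 2 + q 1 ^ 2 ≠ 0 := by
    simpa [EuclideanSpace.norm_sq_eq] using pow_ne_zero 2 (norm_ne_zero_iff.2 hq)
  constructor <;> refine eq_zero_of_forall_ne_zero fun q hq0 =>
    (mul_eq_zero_iff_right (hnorm hq0)).1 ?_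
  · linear_combination q 0 * h₁ q + q 1 * h₂ q
  · linear_combination q 0 * h₂ q - q 1 * h₁ q

/-- The module `E` is free, with basis `v₁`, `v₂`. -/
noncomputable def basisE : Module.Basis (Fin 2) SmoothFun E :=
  Module.Basis.mk
    (v := ![⟨v₁, Submodule.subset_span (by simp)⟩, ⟨v₂, Submodule.subset_span (by simp)⟩])
    (LinearIndependent.pair_iff.2 fun _ _ h =>
      eq_zero_of_smul_add_smul_eq_zero (congrArg (Subtype.val : E → Vect) h))
    (by
      rintro ⟨V, hV⟩ -
      obtain ⟨a, b, h⟩ := Submodule.mem_span_pair.1 hV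
      rw [Matrix.range_cons_cons_empty]
      exact Submodule.mem_span_pair.2 ⟨a, b, Subtype.ext h⟩)

lemma coe_basisE_zero : (basisE 0 : Vect) = v₁ := by simp [basisE]

lemma coe_basisE_one : (basisE 1 : Vect) = v₂ := by simp [basisE]

lemma lie_basisE : ⁅basisE 0, basisE 1⁆ = 0 := by
  refine Subtype.ext ?_
  rw [LieRinehartSubalgebra.coe_bracket, coe_basisE_zero, coe_basisE_one, lie_v₁_v₂]
  rfl

/-- Evaluation at the origin. -/
noncomputable def evalZero : SmoothFun →ₗ[ℝ] ℝ where
  toFun f := f 0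
  map_add' _ _ := rfl
  map_smul' _ _ := rfl

lemma lie_basisE_zero_apply (f : SmoothFun) (q : Plane) : ⁅basisE 0, f⁆ q = fderiv ℝ f q q := by
  rw [LieRinehartSubalgebra.coe_bracket_of_module, coe_basisE_zero, lie_fun_apply, v₁_apply]

lemma isEulerLike_basisE_zero : LieRinehartForms.IsEulerLike evalZero (basisE 0) where
  map_algebraMap _ := rfl
  eq_algebraMap {f} hf := by
    ext1 q
    refine eq_apply_zero_of_fderiv_apply_self_eq_zero (f.contDiff.differentiable (by simp))
      (fun x => ?_) q
    rw [← lie_basisE_zero_apply, hf]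
    rfl
  map_lie f := (lie_basisE_zero_apply f 0).trans (map_zero _)
  exists_lie_eq {f} hf := by
    obtain ⟨g, hg, h⟩ := exists_contDiff_fderiv_apply_self_eq f.contDiff hf
    refine ⟨⟨g, contMDiff_iff_contDiff.2 hg⟩, ?_⟩
    ext1 q
    exact (lie_basisE_zero_apply _ q).trans (h q)

end EllipticPlane

open LieRinehartForms in
theorem mainTheorem4_general {A L : Type*} [CommRing A] [LieRing L] [Module A L]
    [LieRingModule L A] [LieRinehartRing A L] [Algebra ℝ A] [LieAlgebra ℝ L]
    [LieRinehartAlgebra ℝ A L] {ε : A →ₗ[ℝ] ℝ} (e : Module.Basis (Fin 2) A L)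
    (he : ⁅e 0, e 1⁆ = 0) (hX : IsEulerLike ε (e 0)) :
    Nonempty (Cohomology A L 0 ≃ₗ[ℝ] ℝ) ∧
    Nonempty (Cohomology A L 1 ≃ₗ[ℝ] (Fin 2 → ℝ)) ∧
    Nonempty (Cohomology A L 2 ≃ₗ[ℝ] ℝ) ∧
    ∀ k : ℕ, 3 ≤ k → Subsingleton (Cohomology A L k) :=
  ⟨hX.nonempty_cohomology_zero_equiv, nonempty_cohomology_one_equiv e he hX,
    nonempty_cohomology_two_equiv e he hX,
    fun _ hk => subsingleton_cohomology_of_card_lt e (by rw [Fintype.card_fin]; exact hk)⟩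

theorem mainTheorem4 :
    Nonempty (EllipticPlane.ECohomology 0 ≃ₗ[ℝ] ℝ) ∧
    Nonempty (EllipticPlane.ECohomology 1 ≃ₗ[ℝ] (Fin 2 → ℝ)) ∧
    Nonempty (EllipticPlane.ECohomology 2 ≃ₗ[ℝ] ℝ) ∧
    ∀ k : ℕ, 3 ≤ k → Subsingleton (EllipticPlane.ECohomology k) :=
  mainTheorem4_general EllipticPlane.basisE EllipticPlane.lie_basisE
    EllipticPlane.isEulerLike_basisE_zero
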